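/- Let $\sigma=(\sigma_1,\sigma_2,\sigma_3)$ be the Pauli matrices and, for $(a_0,a),(b_0,b)\in\mathbb{R}\times\mathbb{R}^3$, let $A=a_0\mathbb{1}+a\cdot\sigma$ and $B=b_0\mathbb{1}+b\cdot\sigma$ be qubit observables. Let $\mu$ be the Haar-induced probability measure on the set of quantum states (density matrices) $\rho$ on $\mathbb{C}^2$: the law of $\rho=\mathrm{Tr}_2\,(U|\Phi\rangle\langle\Phi|U^\dagger)$, where $U$ is a Haar-distributed element of the full unitary group of $\mathbb{C}^2\otimes\mathbb{C}^2$, $\Phi\in\mathbb{C}^2\otimes\mathbb{C}^2$ is any fixed unit vector, and $\mathrm{Tr}_2$ is the partial trace over the second factor. Write $\langle A\rangle_\rho=\mathrm{Tr}(A\rho)$, $\langle B\rangle_\rho=\mathrm{Tr}(B\rho)$, and let $H$ be the Heaviside function ($H(x)=1$ for $x\ge 0$ and $H(x)=0$ for $x<0$). Let $$T_{a,b}=\begin{pmatrix}\langle a,a\rangle&\langle a,b\rangle\\ \langle b,a\rangle&\langle b,b\rangle\end{pmatrix}.$$ (i) If $\{a,b\}$ is linearly independent, then the joint law of $(\langle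 A\rangle_\rho,\langle B\rangle_\rho)$ under $\mu$ is absolutely continuous with respect to Lebesgue measure on $\mathbb{R}^2$, with density $$f_{\langle A\rangle,\langle B\rangle}(r,s)=\frac{3}{2\pi\sqrt{\det T_{a,b}}}\,\sqrt{1-\omega_{A,B}(r,s)^2}\;H\big(1-\omega_{A,B}(r,s)\big),\qquad \omega_{A,B}(r,s)=\sqrt{(r-a_0,s-b_0)\,T_{a,b}^{-1}\,(r-a_0,s-b_0)^{\mathsf T}},$$ where the product is read as $0$ when $\omega_{A,B}(r,s)>1$. (ii) If $\{a,b\}$ is linearly dependent and $a\neq 0$, then $b=\kappa a$ for some $\kappa\in\mathbb{R}$ (nonzero if $b\ne0$), and $$f_{\langle A\rangle,\langle B\rangle}(r,s)=\delta\big((s-b_0)-\kappa(r-a_0)\big)\,f_{\langle A\rangle}(r),$$ that is, the joint law of $(\langle A\rangle_\rho,\langle B\rangle_\rho)$ is the measure $\varphi\mapsto\int_{\mathbb{R}}\varphi\big(r,\,b_0+\kappa(r-a_0)\big)f_{\langle A\rangle}(r)\,dr$ on $\mathbb{R}^2$. Here $f_{\langle A\rangle}$ is the density of $\langle A\rangle_\rho$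 under $\mu$, which is $$f_{\langle A\rangle}(r)=\frac{3!}{(\lambda_2-\lambda_1)^3}(r-\lambda_1)(\lambda_2-r)\big(H(r-\lambda_1)-H(r-\lambda_2)\big),$$ with $\lambda_1<\lambda_2$ the eigenvalues of $A$. -/

import Mathlib

open MeasureTheory
open scoped ComplexOrder

noncomputable section

namespace QubitMean

/-- Quantum states (density matrices) on `ℂⁿ`: positive semidefinite matrices of trace one,
with the topology and the Borel `σ`-algebra inherited from the space of matrices. -/
abbrev DensityMatrix (n : Type*) [Fintype n] : Type _ :=
  {ρ : Matrix n n ℂ // ρ.PosSemidef ∧ ρ.trace = 1}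

instance instMeasurableSpaceDensityMatrix (n : Type*) [Fintype n] :
    MeasurableSpace (DensityMatrix n) := borel _

instance instBorelSpaceDensityMatrix (n : Type*) [Fintype n] :
    BorelSpace (DensityMatrix n) := ⟨rfl⟩

/-- Unit vectors of the Hilbert space `ℂⁿ`. -/
abbrev PureState (n : Type*) [Fintype n] : Type _ := {ψ : EuclideanSpace ℂ n // ‖ψ‖ = 1}

/-- The partial trace over the second factor of a matrix acting on `ℂᵐ ⊗ ℂⁿ`. -/
def partialTrace {m n : Type*} [Fintype n] (X : Matrix (m × n) (m × n) ℂ) : Matrix m m ℂ :=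
  Matrix.of fun i j => ∑ k, X (i, k) (j, k)

/-- The projector `|ψ⟩⟨ψ|`. -/
def projector {n : Type*} [Fintype n] (ψ : EuclideanSpace ℂ n) : Matrix n n ℂ :=
  Matrix.vecMulVec ψ (star (ψ : n → ℂ))

theorem partialTrace_projector_posSemidef {m n : Type*} [Fintype m] [Fintype n]
    (ψ : EuclideanSpace ℂ (m × n)) : (partialTrace (projector ψ)).PosSemidef := by
  have h : partialTrace (projector ψ)
      = (Matrix.of fun (i : m) (k : n) => ψ (i, k)) *
        (Matrix.of fun (i : m) (k : n) => ψ (i, k)).conjTranspose := by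
    ext i j
    simp [partialTrace, projector, Matrix.mul_apply, Matrix.vecMulVec_apply]
  rw [h]
  exact Matrix.posSemidef_self_mul_conjTranspose _

theorem partialTrace_projector_trace {m n : Type*} [Fintype m] [Fintype n]
    (ψ : EuclideanSpace ℂ (m × n)) (hψ : ‖ψ‖ = 1) : (partialTrace (projector ψ)).trace = 1 := by
  have h : ∑ p : m × n, ψ p * star (ψ p) = 1 := by
    have h1 : ∑ p : m × n, ‖ψ p‖ ^ 2 = 1 := by
      rw [← EuclideanSpace.norm_sq_eq, hψ, one_pow]
    have h2 : ∀ p, ψ p * star (ψ p) = ((‖ψ p‖ ^ 2 : ℝ) : ℂ) := fun p => by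
      simpa using Complex.mul_conj' (ψ p)
    simp_rw [h2]
    rw [← Complex.ofReal_sum, h1, Complex.ofReal_one]
  rw [← h, Fintype.sum_prod_type]
  simp [partialTrace, projector, Matrix.trace, Matrix.vecMulVec_apply]

/-- The reduced state on the first factor of a bipartite pure state. -/
def reducedState {m n : Type*} [Fintype m] [Fintype n] (ψ : PureState (m × n)) :
    DensityMatrix m :=
  ⟨partialTrace (projector ψ.1), partialTrace_projector_posSemidef ψ.1,
    partialTrace_projector_trace ψ.1 ψ.2⟩

theorem unitary_norm {n : Type*} [Fintype n] [DecidableEq n] (U : Matrix.unitaryGroup n ℂ)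
    (ψ : PureState n) : ‖Matrix.toEuclideanLin U.1 ψ.1‖ = 1 := by
  have h := ψ.2
  rw [EuclideanSpace.norm_eq, Real.sqrt_eq_one] at h ⊢
  have key : ∀ v : n → ℂ, ((∑ i, ‖v i‖ ^ 2 : ℝ) : ℂ) = star v ⬝ᵥ v := fun v => by
    simp [dotProduct, Complex.conj_mul']
  have hU : star (U.1.mulVec ψ.1) ⬝ᵥ U.1.mulVec ψ.1 = star (ψ.1 : n → ℂ) ⬝ᵥ (ψ.1 : n → ℂ) := by
    rw [Matrix.star_mulVec, Matrix.dotProduct_mulVec, Matrix.vecMul_vecMul,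
      ← Matrix.star_eq_conjTranspose, Matrix.UnitaryGroup.star_mul_self, Matrix.vecMul_one]
  have h3 := (key (U.1.mulVec ψ.1)).trans (hU.trans (key ψ.1).symm)
  rw [h] at h3
  exact_mod_cast h3

/-- The action `|ψ⟩ ↦ U|ψ⟩` of the unitary group on pure states. -/
def unitaryAct {n : Type*} [Fintype n] [DecidableEq n] (U : Matrix.unitaryGroup n ℂ)
    (ψ : PureState n) : PureState n :=
  ⟨Matrix.toEuclideanLin U.1 ψ.1, unitary_norm U ψ⟩

instance instMeasurableSpaceUnitaryGroup (n : Type*) [Fintype n] [DecidableEq n] :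
    MeasurableSpace (Matrix.unitaryGroup n ℂ) := borel _

instance instBorelSpaceUnitaryGroup (n : Type*) [Fintype n] [DecidableEq n] :
    BorelSpace (Matrix.unitaryGroup n ℂ) := ⟨rfl⟩

instance instCompactSpaceUnitaryGroup (n : Type*) [Fintype n] [DecidableEq n] :
    CompactSpace (Matrix.unitaryGroup n ℂ) := by
  refine isCompact_iff_compactSpace.mp ?_
  have hK : IsCompact (X := Matrix n n ℂ) (Set.univ.pi fun _ : n => Set.univ.pi fun _ : n =>
      Metric.closedBall (0 : ℂ) 1) :=
    isCompact_univ_pi fun _ => isCompact_univ_pi fun _ => isCompact_closedBall _ _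
  refine IsCompact.of_isClosed_subset hK ?_ ?_
  · have h : (Matrix.unitaryGroup n ℂ : Set (Matrix n n ℂ)) = {U | U * star U = 1} := by
      ext U
      exact Matrix.mem_unitaryGroup_iff
    rw [h]
    exact isClosed_eq (by fun_prop) continuous_const
  · intro U hU i _ j _
    simpa using entry_norm_bound_of_unitary hU i j

/-- The Haar probability measure on the unitary group `U(n)`. -/
def haarUnitary (n : Type*) [Fintype n] [DecidableEq n] : Measure (Matrix.unitaryGroup n ℂ) :=
  Measure.haarMeasure ⊤

/-- The Haar-induced measure on the states of `ℂⁿ`: the law of the partial trace over the second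
factor of the random pure state `U|Φ⟩` on `ℂⁿ ⊗ ℂⁿ`, with `U` Haar distributed on the full
unitary group of `ℂⁿ ⊗ ℂⁿ` and `Φ` a fixed pure state. -/
def stateMeasure {n : Type*} [Fintype n] [DecidableEq n] (Φ : PureState (n × n)) :
    Measure (DensityMatrix n) :=
  (haarUnitary (n × n)).map fun U => reducedState (unitaryAct U Φ)

/-- The standard Pauli matrices `σ₁, σ₂, σ₃`. -/
def pauli : Fin 3 → Matrix (Fin 2) (Fin 2) ℂ :=
  ![!![0, 1; 1, 0], !![0, -Complex.I; Complex.I, 0], !![1, 0; 0, -1]]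

/-- The qubit observable `a₀ 𝟙 + a · σ`. -/
def observable (a₀ : ℝ) (a : EuclideanSpace ℝ (Fin 3)) : Matrix (Fin 2) (Fin 2) ℂ :=
  (a₀ : ℂ) • (1 : Matrix (Fin 2) (Fin 2) ℂ) + ∑ i, (a i : ℂ) • pauli i

/-- The mean value `⟨A⟩_ρ = Tr (A ρ)`, a real number for Hermitian `A`. -/
def mean {n : Type*} [Fintype n] (A : Matrix n n ℂ) (ρ : DensityMatrix n) : ℝ :=
  (A * ρ.1).trace.re

/-- The Heaviside function. -/
def heaviside (x : ℝ) : ℝ := if 0 ≤ x then 1 else 0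

/-- The matrix `T_{a,b}` of inner products of `a` and `b`. -/
def gramT (a b : EuclideanSpace ℝ (Fin 3)) : Matrix (Fin 2) (Fin 2) ℝ :=
  !![inner ℝ a a, inner ℝ a b; inner ℝ b a, inner ℝ b b]

/-- `ω_{A,B}(r,s) = √((r - a₀, s - b₀) T⁻¹ (r - a₀, s - b₀)ᵀ)`. -/
def omega (a₀ b₀ : ℝ) (a b : EuclideanSpace ℝ (Fin 3)) (r s : ℝ) : ℝ :=
  Real.sqrt (![r - a₀, s - b₀] ⬝ᵥ (gramT a b)⁻¹.mulVec ![r - a₀, s - b₀])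

/-- The joint density of the mean values for linearly independent `a`, `b`. -/
def jointDensity (a₀ b₀ : ℝ) (a b : EuclideanSpace ℝ (Fin 3)) (r s : ℝ) : ℝ :=
  3 / (2 * Real.pi * Real.sqrt (gramT a b).det) * Real.sqrt (1 - omega a₀ b₀ a b r s ^ 2) *
    heaviside (1 - omega a₀ b₀ a b r s)

/-- The smallest eigenvalue `λ₁(A)` of a Hermitian `2 × 2` matrix. -/
def eigMin (A : Matrix (Fin 2) (Fin 2) ℂ) : ℝ := sInf (spectrum ℝ A)

/-- The largest eigenvalue `λ₂(A)` of a Hermitian `2 × 2` matrix. -/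
def eigMax (A : Matrix (Fin 2) (Fin 2) ℂ) : ℝ := sSup (spectrum ℝ A)

/-- The density of the mean value of one qubit observable,
`3! / V³ · (r - λ₁)(λ₂ - r)(H(r - λ₁) - H(r - λ₂))`, where `V = λ₂ - λ₁`. -/
def meanDensity (A : Matrix (Fin 2) (Fin 2) ℂ) (r : ℝ) : ℝ :=
  (Nat.factorial 3 : ℝ) / (eigMax A - eigMin A) ^ 3 * (r - eigMin A) * (eigMax A - r) *
    (heaviside (r - eigMin A) - heaviside (r - eigMax A))

/-- The measure `δ((s - b₀) - κ (r - a₀)) dr ds` on the plane: its integral of a test function `φ`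
is `∫ φ(r, b₀ + κ (r - a₀)) dr`. -/
def deltaLine (a₀ b₀ κ : ℝ) : Measure (ℝ × ℝ) :=
  (volume : Measure ℝ).map fun r => (r, b₀ + κ * (r - a₀))

end QubitMean

end

/-! The reduced state of a Haar-random two-qubit vector is uniform in the Bloch ball, so each mean
is an affine function of the projection of a uniform point onto a line, and a pair of means comes
from its projection onto a plane. The proof bypasses the Bloch vector and works with `discLaw`, the
shadow of the uniform ball on a plane.

One-dimensional input: in a Haar-random unit vector of `ℂ² ⊗ ℂ²`, the weight in `e₀ ⊗ ℂ²` has the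
beta(2,2) law (`map_topWeight`). Its moments are obtained by comparing sphere averages with Gaussian
integrals (`lintegral_haarUnitary_mul`), which factor over the two copies of `ℂ²`; moments determine
a law on `[0,1]`. Diagonalizing an observable by a local unitary, which left invariance of Haar
measure absorbs, makes its mean an affine function of this weight. Since beta(2,2) is affinely the
first marginal of `discLaw`, the mean of `a₀ 𝟙 + a · σ` is distributed as `‖a‖ x + a₀` on the disc
(`map_mean_observable`).

Two-dimensional step: a linear combination of two means is again the mean of an observable, so every
one-dimensional projection of the joint law is known. By rotation invariance of `discLaw` these are
the projections of its image under an affine map built from the Cholesky factor of the Gram matrix.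
Cramér–Wold (`ext_of_map_linear`) then identifies the joint law, and a change of variables gives the
density (`map_affine_discLaw`). In the dependent case the pair is a function of the first mean
alone. -/

noncomputable section

namespace QubitMean

/-! ### Push-forwards of densities, and the moment problem on an interval -/

/-- Push-forward of a density that factors through the map. -/
theorem map_withDensity_comp {α β : Type*} [MeasurableSpace α] [MeasurableSpace β]
    {μ : Measure α} {ν : Measure β} {c : ENNReal} {f : α → β} {g : β → ENNReal}
    (hf : Measurable f) (hg : Measurable g) (h : μ.map f = c • ν) :
    (μ.withDensity (g ∘ f)).map f = c • ν.withDensity g := by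
  rw [← withDensity_smul_measure, ← h]
  ext s hs
  rw [Measure.map_apply hf hs, withDensity_apply _ (hf hs), withDensity_apply _ hs,
    setLIntegral_map hs hg hf]
  rfl

/-- The first marginal of a measure with a density with respect to a product measure. -/
theorem map_fst_withDensity_prod {α β : Type*} [MeasurableSpace α] [MeasurableSpace β]
    {μ : Measure α} {ν : Measure β} [SFinite μ] [SFinite ν] {f : α × β → ENNReal}
    (hf : Measurable f) :
    ((μ.prod ν).withDensity f).map Prod.fst = μ.withDensity fun x => ∫⁻ y, f (x, y) ∂ν := by
  ext s hs
  rw [Measure.map_apply measurable_fst hs, withDensity_apply _ (measurable_fst hs),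
    withDensity_apply _ hs]
  have h : Prod.fst ⁻¹' s = s ×ˢ (Set.univ : Set β) := by ext; simp
  rw [h, ← Measure.prod_restrict, Measure.restrict_univ, lintegral_prod _ hf.aemeasurable]

/-- Finite measures on a compact interval are determined by their moments. -/
theorem ext_of_moments {μ ν : Measure ℝ} [IsFiniteMeasure μ] [IsFiniteMeasure ν] {a b : ℝ}
    (hμ : ∀ᵐ x ∂μ, x ∈ Set.Icc a b) (hν : ∀ᵐ x ∂ν, x ∈ Set.Icc a b)
    (h : ∀ k : ℕ, ∫ x, x ^ k ∂μ = ∫ x, x ^ k ∂ν) : μ = ν := by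
  have hint : ∀ (ρ : Measure ℝ) [IsFiniteMeasure ρ], (∀ᵐ x ∂ρ, x ∈ Set.Icc a b) →
      ∀ f : ℝ → ℝ, Continuous f → Integrable f ρ := by
    intro ρ _ hρ f hf
    obtain ⟨C, hC⟩ := isCompact_Icc.exists_bound_of_continuousOn (hf.continuousOn (s := Set.Icc a b))
    exact Integrable.of_bound hf.aestronglyMeasurable C (hρ.mono hC)
  have hpoly : ∀ p : Polynomial ℝ, ∫ x, p.eval x ∂μ = ∫ x, p.eval x ∂ν := by
    intro p
    simp_rw [Polynomial.eval_eq_sum_range]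
    rw [integral_finsetSum _ fun i _ => hint μ hμ _ (by fun_prop),
      integral_finsetSum _ fun i _ => hint ν hν _ (by fun_prop)]
    simp_rw [integral_const_mul, h]
  refine ext_of_forall_integral_eq_of_IsFiniteMeasure fun f => ?_
  by_contra hne
  -- The extra `1` makes the total error `d / M * (M - 1)` strictly smaller than `d` when `f` is
  -- approximated within `d / M` by a polynomial.
  set M : ℝ := μ.real Set.univ + ν.real Set.univ + 1 with hM
  have hM0 : 0 < M := by positivity
  set d : ℝ := |∫ x, f x ∂μ - ∫ x, f x ∂ν| with hd
  have hd0 : 0 < d := abs_pos.mpr (sub_ne_zero.mpr hne)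
  obtain ⟨p, hp⟩ := exists_polynomial_near_of_continuousOn a b f f.continuous.continuousOn
    (d / M) (by positivity)
  have hb : ∀ (ρ : Measure ℝ) [IsFiniteMeasure ρ], (∀ᵐ x ∂ρ, x ∈ Set.Icc a b) →
      |∫ x, p.eval x ∂ρ - ∫ x, f x ∂ρ| ≤ d / M * ρ.real Set.univ := by
    intro ρ _ hρ
    rw [← integral_sub (hint ρ hρ _ p.continuous) (hint ρ hρ _ f.continuous)]
    rw [← Real.norm_eq_abs]
    exact norm_integral_le_of_norm_le_const (hρ.mono fun x hx => (hp x hx).le)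
  have h1 := hb μ hμ
  have h2 := hb ν hν
  rw [hpoly] at h1
  have h3 : d ≤ d / M * (M - 1) := by
    have := abs_sub_le (∫ x, f x ∂μ) (∫ x, p.eval x ∂ν) (∫ x, f x ∂ν)
    rw [abs_sub_comm (∫ x, f x ∂μ) (∫ x, p.eval x ∂ν)] at this
    have hM' : M - 1 = μ.real Set.univ + ν.real Set.univ := by rw [hM]; ring
    rw [hM', mul_add]
    linarith
  have h4 : d / M * M = d := div_mul_cancel₀ d hM0.ne'
  have h5 : 0 < d / M := by positivity
  linarith

/-! ### The beta law, the disc law and Cramér–Wold -/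

/-- The beta distribution with parameters `(2, 2)`. -/
def betaLaw : Measure ℝ := volume.withDensity fun u => ENNReal.ofReal (6 * u * (1 - u))

/-- No explicit cutoff is needed in `betaLaw`: the quadratic is nonpositive off the interval, where
`ENNReal.ofReal` truncates it to zero. -/
theorem betaDensity_eq_indicator : (fun u : ℝ => ENNReal.ofReal (6 * u * (1 - u))) =
    (Set.Ioc (0 : ℝ) 1).indicator fun u => ENNReal.ofReal (6 * u * (1 - u)) := by
  ext u
  by_cases hu : u ∈ Set.Ioc (0 : ℝ) 1
  · rw [Set.indicator_of_mem hu]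
  · rw [Set.indicator_of_notMem hu, ENNReal.ofReal_eq_zero]
    rw [Set.mem_Ioc, not_and_or, not_lt, not_le] at hu
    rcases hu with hu | hu <;> nlinarith

theorem betaLaw_eq_restrict : betaLaw =
    (volume.restrict (Set.Ioc (0 : ℝ) 1)).withDensity
      fun u => ENNReal.ofReal (6 * u * (1 - u)) := by
  rw [betaLaw, betaDensity_eq_indicator, withDensity_indicator measurableSet_Ioc]
  simp only [← betaDensity_eq_indicator]

theorem integral_pow_betaLaw (k : ℕ) :
    ∫ x, x ^ k ∂betaLaw = 6 / ((k + 2) * (k + 3)) := by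
  rw [betaLaw_eq_restrict, integral_withDensity_eq_integral_toReal_smul (by fun_prop) (by simp)]
  have h : ∀ u ∈ Set.Ioc (0 : ℝ) 1, (ENNReal.ofReal (6 * u * (1 - u))).toReal • u ^ k =
      6 * u ^ (k + 1) - 6 * u ^ (k + 2) := by
    intro u hu
    rw [ENNReal.toReal_ofReal (by nlinarith [hu.1, hu.2]), smul_eq_mul]
    ring
  rw [setIntegral_congr_fun measurableSet_Ioc h, ← intervalIntegral.integral_of_le zero_le_one,
    intervalIntegral.integral_sub (Continuous.intervalIntegrable (by fun_prop) _ _)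
      (Continuous.intervalIntegrable (by fun_prop) _ _)]
  simp only [intervalIntegral.integral_const_mul, integral_pow]
  have h2 : (k : ℝ) + 2 ≠ 0 := by positivity
  have h3 : (k : ℝ) + 3 ≠ 0 := by positivity
  have h4 : (k : ℝ) + 1 + 1 ≠ 0 := by positivity
  have h5 : (k : ℝ) + 2 + 1 ≠ 0 := by positivity
  push_cast
  simp
  field_simp
  ring

instance : IsProbabilityMeasure betaLaw := by
  constructor
  have h := integral_pow_betaLaw 0
  simp only [pow_zero, integral_const, smul_eq_mul, mul_one] at h
  norm_num [Measure.real] at h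
  rwa [ENNReal.toReal_eq_one_iff] at h

theorem ae_mem_betaLaw : ∀ᵐ x ∂betaLaw, x ∈ Set.Icc (0 : ℝ) 1 := by
  rw [betaLaw_eq_restrict]
  refine (withDensity_absolutelyContinuous _ _).ae_le ?_
  filter_upwards [ae_restrict_mem measurableSet_Ioc] with x hx using ⟨hx.1.le, hx.2⟩

/-- The law of the projection of a uniform point of the unit ball of `ℝ³` onto a plane. -/
def discLaw : Measure (ℝ × ℝ) :=
  volume.withDensity fun p => ENNReal.ofReal (3 / (2 * Real.pi) * √(1 - (p.1 ^ 2 + p.2 ^ 2)))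

theorem integral_sqrt_sub_sq {c : ℝ} (hc : 0 < c) :
    ∫ y, √(c ^ 2 - y ^ 2) = Real.pi / 2 * c ^ 2 := by
  have h0 : ∀ y ∉ Set.Ioc (-c) c, √(c ^ 2 - y ^ 2) = 0 := by
    intro y hy
    rw [Real.sqrt_eq_zero']
    rw [Set.mem_Ioc, not_and_or, not_lt, not_le] at hy
    rcases hy with hy | hy <;> nlinarith
  rw [← setIntegral_eq_integral_of_forall_compl_eq_zero h0,
    ← intervalIntegral.integral_of_le (by linarith)]
  -- Rescaling by `c` reduces to the area of the unit half disc.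
  have h := intervalIntegral.integral_comp_mul_left (fun y => √(c ^ 2 - y ^ 2)) hc.ne'
    (a := -1) (b := 1)
  have h1 : ∀ x : ℝ, √(c ^ 2 - (c * x) ^ 2) = c * √(1 - x ^ 2) := by
    intro x
    rw [show c ^ 2 - (c * x) ^ 2 = c ^ 2 * (1 - x ^ 2) by ring, Real.sqrt_mul (by positivity),
      Real.sqrt_sq hc.le]
  simp_rw [h1] at h
  rw [intervalIntegral.integral_const_mul, integral_sqrt_one_sub_sq, mul_neg, mul_one,
    smul_eq_mul] at h
  rw [eq_comm, inv_mul_eq_iff_eq_mul₀ hc.ne'] at h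
  rw [h]; ring

theorem lintegral_discDensity (x : ℝ) :
    ∫⁻ y : ℝ, ENNReal.ofReal (3 / (2 * Real.pi) * √(1 - (x ^ 2 + y ^ 2))) =
      ENNReal.ofReal (3 / 4 * (1 - x ^ 2)) := by
  rcases le_or_gt 1 (x ^ 2) with hx | hx
  · rw [ENNReal.ofReal_of_nonpos (by linarith)]
    have : ∀ y : ℝ, √(1 - (x ^ 2 + y ^ 2)) = 0 := fun y => by
      rw [Real.sqrt_eq_zero']; nlinarith [sq_nonneg y]
    simp [this]
  · have hc : 0 < √(1 - x ^ 2) := Real.sqrt_pos.mpr (by linarith)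
    have h := integral_sqrt_sub_sq hc
    rw [Real.sq_sqrt (by linarith)] at h
    have h1 : ∀ y : ℝ, 1 - (x ^ 2 + y ^ 2) = 1 - x ^ 2 - y ^ 2 := fun y => by ring
    simp_rw [h1]
    have hi : Integrable fun y : ℝ => √(1 - x ^ 2 - y ^ 2) := by
      -- A non-integrable function would have Bochner integral `0` by convention, contradicting the
      -- positive value just computed.
      by_contra hni
      rw [integral_undef hni] at h
      have hx' : 0 < 1 - x ^ 2 := by linarith
      have : 0 < Real.pi / 2 * (1 - x ^ 2) := by positivity
      linarith
    rw [← ofReal_integral_eq_lintegral_ofReal (hi.const_mul _)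
      (Filter.Eventually.of_forall fun y => by positivity), integral_const_mul, h]
    congr 1
    field_simp
    ring

theorem map_fst_discLaw :
    discLaw.map Prod.fst = volume.withDensity fun x : ℝ => ENNReal.ofReal (3 / 4 * (1 - x ^ 2)) := by
  rw [discLaw, Measure.volume_eq_prod, map_fst_withDensity_prod (by fun_prop)]
  simp_rw [lintegral_discDensity]

theorem map_mul_add_volume {α : ℝ} (hα : α ≠ 0) (c : ℝ) :
    (volume : Measure ℝ).map (fun x => α * x + c) = ENNReal.ofReal |α⁻¹| • volume := by
  have : (fun x : ℝ => α * x + c) = (fun x => x + c) ∘ fun x => α * x := rfl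
  rw [this, ← Measure.map_map (by fun_prop) (by fun_prop), Real.map_volume_mul_left hα,
    Measure.map_smul, map_add_right_eq_self]

/-- Push-forward of a density on the line under an affine map. -/
theorem map_mul_add_withDensity {α c : ℝ} (hα : α ≠ 0) {g f : ℝ → ℝ} (hg : Measurable g)
    (h : ∀ x, f x = |α| * g (α * x + c)) :
    (volume.withDensity fun x => ENNReal.ofReal (f x)).map (fun x => α * x + c) =
      volume.withDensity fun x => ENNReal.ofReal (g x) := by
  have h1 : (fun x => ENNReal.ofReal (f x)) =
      (fun y => ENNReal.ofReal (|α| * g y)) ∘ fun x => α * x + c := by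
    ext x; simp [h]
  rw [h1, map_withDensity_comp (by fun_prop) (by fun_prop) (map_mul_add_volume hα c),
    ← withDensity_smul _ (by fun_prop)]
  congr 1
  ext x
  rw [Pi.smul_apply, smul_eq_mul, ← ENNReal.ofReal_mul (abs_nonneg _), ← mul_assoc, ← abs_mul,
    inv_mul_cancel₀ hα, abs_one, one_mul]

/-- The substitution `x = 2u - 1` turns `6u(1 - u) du` into `(3/4)(1 - x²) dx`, the law of one
coordinate of a uniform point of the ball. -/
theorem map_betaLaw_eq_map_fst_discLaw :
    betaLaw.map (fun u => 2 * u + (-1)) = discLaw.map Prod.fst := by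
  rw [map_fst_discLaw, betaLaw]
  refine map_mul_add_withDensity two_ne_zero (by fun_prop) fun x => ?_
  rw [abs_two]; ring

/-- The linear map `(x, y) ↦ (a x + b y, c x + d y)` of the plane. -/
def planeMap (a b c d : ℝ) : ℝ × ℝ →ₗ[ℝ] ℝ × ℝ :=
  Matrix.toLin (Module.Basis.finTwoProd ℝ) (Module.Basis.finTwoProd ℝ) !![a, b; c, d]

theorem map_planeMap_volume {a b c d : ℝ} (h : a * d - b * c ≠ 0) :
    (volume : Measure (ℝ × ℝ)).map (fun p => (a * p.1 + b * p.2, c * p.1 + d * p.2)) =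
      ENNReal.ofReal |(a * d - b * c)⁻¹| • volume := by
  have hdet : LinearMap.det (planeMap a b c d) = a * d - b * c := by
    rw [planeMap, LinearMap.det_toLin, Matrix.det_fin_two_of]
  rw [← hdet, ← Measure.map_linearMap_addHaar_eq_smul_addHaar volume (by rwa [hdet])]
  congr 1
  ext p <;> simp [planeMap, Matrix.toLin_finTwoProd_apply]

/-- The density depends only on `x² + y²` and a rotation has determinant one. -/
theorem map_rotation_discLaw {c s : ℝ} (h : c ^ 2 + s ^ 2 = 1) :
    discLaw.map (fun p => (c * p.1 + s * p.2, -s * p.1 + c * p.2)) = discLaw := by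
  have hd : c * c - s * -s = 1 := by linarith
  have hv := map_planeMap_volume (a := c) (b := s) (c := -s) (d := c) (by rw [hd]; simp)
  rw [hd] at hv
  have := map_withDensity_comp (g := fun p : ℝ × ℝ =>
    ENNReal.ofReal (3 / (2 * Real.pi) * √(1 - (p.1 ^ 2 + p.2 ^ 2)))) (by fun_prop) (by fun_prop) hv
  simp only [inv_one, abs_one, ENNReal.ofReal_one, one_smul] at this
  rw [discLaw]
  conv_rhs => rw [← this]
  congr 2
  ext p
  simp only [Function.comp]
  congr 4
  linear_combination -(p.1 ^ 2 + p.2 ^ 2) * h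

/-- Linear functionals of the same norm have the same law on the disc. -/
theorem map_linear_discLaw (α β r : ℝ) (h : α ^ 2 + β ^ 2 = r ^ 2) :
    discLaw.map (fun p => α * p.1 + β * p.2) = discLaw.map fun p => r * p.1 := by
  by_cases hr : r = 0
  · have h1 : α = 0 := by rw [hr] at h; nlinarith [sq_nonneg α, sq_nonneg β]
    have h2 : β = 0 := by rw [hr] at h; nlinarith [sq_nonneg α, sq_nonneg β]
    simp [h1, h2, hr]
  -- This rotation has first coordinate `(α x + β y) / r`, so it carries `r x` to the given
  -- functional.
  · conv_rhs => rw [← map_rotation_discLaw (c := α / r) (s := β / r) (by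
      rw [div_pow, div_pow, ← add_div, h, div_self (by positivity)]),
      Measure.map_map (by fun_prop) (by fun_prop)]
    congr 1
    ext p
    simp only [Function.comp]
    field_simp

instance : IsProbabilityMeasure discLaw := by
  have : IsProbabilityMeasure (discLaw.map Prod.fst) := by
    rw [← map_betaLaw_eq_map_fst_discLaw]
    exact Measure.isProbabilityMeasure_map (by fun_prop)
  exact Measure.isProbabilityMeasure_of_map Prod.fst

/-- **Cramér–Wold** in the plane. -/
theorem ext_of_map_linear {μ ν : Measure (ℝ × ℝ)} [IsFiniteMeasure μ] [IsFiniteMeasure ν]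
    (h : ∀ s t : ℝ, μ.map (fun p => s * p.1 + t * p.2) = ν.map fun p => s * p.1 + t * p.2) :
    μ = ν := by
  -- The characteristic function at `L` depends only on the law of `L`.
  refine Measure.ext_of_charFunDual (funext fun L => ?_)
  have hL : (L : ℝ × ℝ → ℝ) = fun p => L (1, 0) * p.1 + L (0, 1) * p.2 := by
    ext p
    have : p = p.1 • ((1 : ℝ), (0 : ℝ)) + p.2 • ((0 : ℝ), (1 : ℝ)) := by ext <;> simp
    conv_lhs => rw [this, map_add, map_smul, map_smul]
    simp only [smul_eq_mul]; ring
  rw [charFunDual_eq_charFun_map_one, charFunDual_eq_charFun_map_one, hL, h]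

/-! ### Haar averages over the unitary group and integrals over `ℂⁿ` -/

section Unitary

variable {n : Type*} [Fintype n] [DecidableEq n]

instance : (haarUnitary n).IsHaarMeasure := by unfold haarUnitary; infer_instance

instance : IsProbabilityMeasure (haarUnitary n) := ⟨by
  have := Measure.haarMeasure_self (K₀ := (⊤ : TopologicalSpace.PositiveCompacts
    (Matrix.unitaryGroup n ℂ)))
  rwa [TopologicalSpace.PositiveCompacts.coe_top] at this⟩

/-- Unimodularity of a compact group: a right translate is again a left Haar probability measure,
and there is only one. -/
theorem map_mul_right_haarUnitary (V : Matrix.unitaryGroup n ℂ) :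
    (haarUnitary n).map (· * V) = haarUnitary n := by
  have : IsProbabilityMeasure ((haarUnitary n).map (· * V)) :=
    Measure.isProbabilityMeasure_map (measurable_mul_const V).aemeasurable
  exact Measure.isHaarMeasure_eq_of_isProbabilityMeasure _ _

theorem map_mul_left_haarUnitary (V : Matrix.unitaryGroup n ℂ) :
    (haarUnitary n).map (V * ·) = haarUnitary n :=
  map_mul_left_eq_self _ _

theorem toEuclideanLin_mul (A B : Matrix n n ℂ) (v : EuclideanSpace ℂ n) :
    Matrix.toEuclideanLin (A * B) v = Matrix.toEuclideanLin A (Matrix.toEuclideanLin B v) := by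
  simp [Matrix.toLpLin_apply, Matrix.mulVec_mulVec]

theorem unitaryAct_mul (U V : Matrix.unitaryGroup n ℂ) (ψ : PureState n) :
    unitaryAct (U * V) ψ = unitaryAct U (unitaryAct V ψ) :=
  Subtype.ext (toEuclideanLin_mul U.1 V.1 ψ.1)

theorem continuous_toEuclideanLin :
    Continuous fun p : Matrix.unitaryGroup n ℂ × EuclideanSpace ℂ n =>
      Matrix.toEuclideanLin p.1.1 p.2 := by
  simp only [Matrix.toLpLin_apply]
  fun_prop

theorem continuous_unitaryAct (Φ : PureState n) :
    Continuous fun U : Matrix.unitaryGroup n ℂ => (unitaryAct U Φ).1 := by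
  simp only [unitaryAct, Matrix.toLpLin_apply]
  fun_prop

/-- The linear isometry given by a unitary matrix. -/
def unitaryIsometry (U : Matrix.unitaryGroup n ℂ) :
    EuclideanSpace ℂ n →ₗᵢ[ℂ] EuclideanSpace ℂ n where
  toLinearMap := Matrix.toEuclideanLin U.1
  norm_map' v := by
    rcases eq_or_ne v 0 with rfl | hv
    · simp
    · have hv' : (‖v‖ : ℂ) ≠ 0 := by simpa using hv
      have h := unitary_norm U ⟨(‖v‖ : ℂ)⁻¹ • v, by simp [norm_smul, hv]⟩
      rw [map_smul, norm_smul] at h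
      simp only [norm_inv, Complex.norm_real, norm_norm] at h
      exact (inv_mul_eq_one₀ (by simpa using hv)).mp h |>.symm

theorem measurePreserving_toEuclideanLin (U : Matrix.unitaryGroup n ℂ) :
    MeasurePreserving (Matrix.toEuclideanLin U.1 : EuclideanSpace ℂ n → EuclideanSpace ℂ n) := by
  let e : EuclideanSpace ℂ n ≃ₗᵢ[ℂ] EuclideanSpace ℂ n :=
    (unitaryIsometry U).toLinearIsometryEquiv rfl
  -- Volume preservation is a statement about real isometries, hence the restriction of scalars.
  let e' : EuclideanSpace ℂ n ≃ₗᵢ[ℝ] EuclideanSpace ℂ n :=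
    { e.toLinearEquiv.restrictScalars ℝ with norm_map' := e.norm_map }
  exact e'.measurePreserving

/-- The unitary group acts transitively on unit vectors. -/
theorem exists_unitaryAct_eq (Φ Ψ : PureState n) :
    ∃ V : Matrix.unitaryGroup n ℂ, unitaryAct V Φ = Ψ := by
  have hne : Nonempty n := by
    by_contra h
    rw [not_nonempty_iff] at h
    have := Φ.2
    rw [EuclideanSpace.norm_eq] at this
    simp at this
  obtain ⟨i⟩ := hne
  -- Completing a unit vector to an orthonormal basis gives a unitary with that vector as its `i`-th
  -- column; two such unitaries then combine as `W * V⁻¹`.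
  have key : ∀ Φ : PureState n, ∃ V : Matrix.unitaryGroup n ℂ,
      V.1.mulVec (Pi.single i 1) = Φ.1 := by
    intro Φ
    have ho : Orthonormal ℂ (Set.domRestrict {i} fun _ : n => Φ.1) := by
      refine ⟨fun j => Φ.2, fun j k hjk => (hjk (Subsingleton.elim _ _)).elim⟩
    obtain ⟨b, hb⟩ := ho.exists_orthonormalBasis_extension_of_card_eq (by simp)
    refine ⟨⟨_, (EuclideanSpace.basisFun n ℂ).toMatrix_orthonormalBasis_mem_unitary b⟩, ?_⟩
    ext j
    rw [Matrix.mulVec_single_one]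
    have := hb i rfl
    simp [Module.Basis.toMatrix_apply, this]
  obtain ⟨V, hV⟩ := key Φ
  obtain ⟨W, hW⟩ := key Ψ
  refine ⟨W * V⁻¹, Subtype.ext ?_⟩
  ext j
  have h1 : (V⁻¹).1.mulVec Φ.1 = Pi.single i 1 := by
    rw [← hV, Matrix.mulVec_mulVec]
    have : (V⁻¹).1 * V.1 = 1 := congrArg Subtype.val (inv_mul_cancel V)
    rw [this, Matrix.one_mulVec]
  have h2 : (W * V⁻¹).1.mulVec Φ.1 = Ψ.1 := by
    rw [show (W * V⁻¹).1 = W.1 * (V⁻¹).1 from rfl, ← Matrix.mulVec_mulVec, h1, hW]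
  exact congrFun h2 j

/-- By transitivity `Ψ = VΦ`, and right invariance absorbs `V`. -/
theorem lintegral_haarUnitary_eq {f : EuclideanSpace ℂ n → ENNReal} (hf : Measurable f)
    (Φ Ψ : PureState n) :
    ∫⁻ U, f (Matrix.toEuclideanLin U.1 Φ.1) ∂haarUnitary n =
      ∫⁻ U, f (Matrix.toEuclideanLin U.1 Ψ.1) ∂haarUnitary n := by
  obtain ⟨V, hV⟩ := exists_unitaryAct_eq Φ Ψ
  have hm : Measurable fun U : Matrix.unitaryGroup n ℂ => f (Matrix.toEuclideanLin U.1 Φ.1) :=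
    hf.comp (continuous_toEuclideanLin.comp (by fun_prop : Continuous fun U => (U, Φ.1))).measurable
  rw [← map_mul_right_haarUnitary V, lintegral_map hm (measurable_mul_const V),
    map_mul_right_haarUnitary V]
  refine lintegral_congr fun U => ?_
  rw [← hV]
  exact congrArg f (toEuclideanLin_mul _ _ _)

/-- Averages of a homogeneous function over the sphere computed with a radial weight. -/
theorem lintegral_haarUnitary_mul {f : EuclideanSpace ℂ n → ENNReal} (hf : Continuous f)
    {d : ℕ} (hd : ∀ (c : ℝ), 0 ≤ c → ∀ v, f ((c : ℂ) • v) = ENNReal.ofReal (c ^ d) * f v)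
    {w : ℝ → ENNReal} (hw : Measurable w) (Φ : PureState n) :
    (∫⁻ U, f (Matrix.toEuclideanLin U.1 Φ.1) ∂haarUnitary n) *
        ∫⁻ v : EuclideanSpace ℂ n, ENNReal.ofReal (‖v‖ ^ d) * w ‖v‖ =
      ∫⁻ v : EuclideanSpace ℂ n, f v * w ‖v‖ := by
  have hne : Nonempty n := by
    by_contra h
    rw [not_nonempty_iff] at h
    have := Φ.2
    rw [EuclideanSpace.norm_eq] at this
    simp at this
  have h1 : ∀ U : Matrix.unitaryGroup n ℂ,
      ∫⁻ v : EuclideanSpace ℂ n, f (Matrix.toEuclideanLin U.1 v) * w ‖v‖ =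
        ∫⁻ v : EuclideanSpace ℂ n, f v * w ‖v‖ := by
    intro U
    rw [← (measurePreserving_toEuclideanLin U).lintegral_comp
      (f := fun v => f v * w ‖v‖) (hf.measurable.mul (by fun_prop))]
    refine lintegral_congr fun v => ?_
    rw [show ‖Matrix.toEuclideanLin U.1 v‖ = ‖v‖ from (unitaryIsometry U).norm_map v]
  -- For fixed `v ≠ 0`, homogeneity extracts `‖v‖ ^ d` and the remaining average does not depend on
  -- the direction. Integrating over `v` and exchanging the integrals, with `h1` evaluating the
  -- inner one, gives the claim.
  have h2 : ∀ᵐ v : EuclideanSpace ℂ n,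
      ∫⁻ U, f (Matrix.toEuclideanLin U.1 v) * w ‖v‖ ∂haarUnitary n =
        (∫⁻ U, f (Matrix.toEuclideanLin U.1 Φ.1) ∂haarUnitary n) *
          (ENNReal.ofReal (‖v‖ ^ d) * w ‖v‖) := by
    filter_upwards [Measure.ae_ne volume (0 : EuclideanSpace ℂ n)] with v hv
    have hm : ∀ v, Measurable fun U : Matrix.unitaryGroup n ℂ => f (Matrix.toEuclideanLin U.1 v) :=
      fun v => (hf.comp (continuous_toEuclideanLin.comp
        (by fun_prop : Continuous fun U => (U, v)))).measurable
    rw [lintegral_mul_const _ (hm v)]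
    have hv' : (‖v‖ : ℂ) ≠ 0 := by simpa using hv
    let Ψ : PureState n := ⟨(‖v‖ : ℂ)⁻¹ • v, by simp [norm_smul, hv]⟩
    have hΨ : v = (‖v‖ : ℂ) • Ψ.1 := by simp [Ψ, smul_smul, hv']
    have : ∀ U : Matrix.unitaryGroup n ℂ, f (Matrix.toEuclideanLin U.1 v) =
        ENNReal.ofReal (‖v‖ ^ d) * f (Matrix.toEuclideanLin U.1 Ψ.1) := by
      intro U
      conv_lhs => rw [hΨ, map_smul, hd _ (norm_nonneg _)]
    simp_rw [this]
    rw [lintegral_const_mul _ (hm _), lintegral_haarUnitary_eq hf.measurable Ψ Φ]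
    ring
  rw [← lintegral_const_mul _ (by fun_prop), ← lintegral_congr_ae h2, ← lintegral_lintegral_swap]
  · simp_rw [h1]
    simp
  · exact (((hf.comp continuous_toEuclideanLin).measurable).mul (by fun_prop)).aemeasurable

end Unitary

/-! ### Gaussian moments and the law of the weight -/

/-- Gaussian radial moments in a real inner product space of even dimension `2 d`. -/
theorem lintegral_norm_pow_mul_exp {E : Type*} [NormedAddCommGroup E] [NormedSpace ℝ E]
    [Nontrivial E] [FiniteDimensional ℝ E] [MeasurableSpace E] [BorelSpace E] (μ : Measure E)
    [μ.IsAddHaarMeasure] {d : ℕ} (hd : Module.finrank ℝ E = 2 * (d + 1)) (k : ℕ) :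
    ∫⁻ v : E, ENNReal.ofReal (‖v‖ ^ (2 * k)) * ENNReal.ofReal (Real.exp (-‖v‖ ^ 2)) ∂μ =
      ENNReal.ofReal (μ.real (Metric.ball 0 1) * (d + 1)) * ENNReal.ofReal ((k + d).factorial) := by
  have hb : 0 < μ.real (Metric.ball (0 : E) 1) :=
    ENNReal.toReal_pos (Metric.measure_ball_pos μ 0 one_pos).ne' measure_ball_lt_top.ne
  have hr : ∫ y in Set.Ioi (0 : ℝ), y ^ (2 * (d + 1) - 1) • (y ^ (2 * k) * Real.exp (-y ^ 2)) =
      (k + d).factorial / 2 := by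
    -- The exponent is `2k` plus the polar Jacobian exponent `2(d + 1) - 1`; the Gamma value is then
    -- `Γ(k + d + 1) = (k + d)!`.
    have h := integral_rpow_mul_exp_neg_rpow (p := 2) (q := 2 * (k + d) + 1) (by norm_num) (by
      have : (0 : ℝ) ≤ k + d := by positivity
      linarith)
    have h3 : ((2 * ((k : ℝ) + d) + 1) + 1) / 2 = (k + d : ℕ) + 1 := by push_cast; ring
    rw [h3, Real.Gamma_nat_eq_factorial] at h
    rw [div_eq_inv_mul, ← one_div, ← h]
    refine setIntegral_congr_fun measurableSet_Ioi fun y (hy : 0 < y) => ?_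
    simp only [smul_eq_mul]
    rw [← mul_assoc, ← pow_add]
    congr 1
    · rw [← Real.rpow_natCast]
      congr 1
      rw [show 2 * (d + 1) - 1 + 2 * k = 2 * (k + d) + 1 by omega]
      push_cast; ring
    · rw [← Real.rpow_natCast]; norm_num
  have hI := integral_fun_norm_addHaar μ fun y => y ^ (2 * k) * Real.exp (-y ^ 2)
  rw [hd, hr] at hI
  have hI' : ∫ v : E, ‖v‖ ^ (2 * k) * Real.exp (-‖v‖ ^ 2) ∂μ =
      μ.real (Metric.ball 0 1) * (d + 1) * (k + d).factorial := by
    rw [hI]; simp only [nsmul_eq_mul, smul_eq_mul]; push_cast; ring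
  have hi : Integrable (fun v : E => ‖v‖ ^ (2 * k) * Real.exp (-‖v‖ ^ 2)) μ := by
    by_contra hni
    rw [integral_undef hni] at hI'
    have : 0 < μ.real (Metric.ball (0 : E) 1) * (d + 1) * (k + d).factorial := by positivity
    exact this.ne hI'
  rw [← ENNReal.ofReal_mul (by positivity), ← hI', ofReal_integral_eq_lintegral_ofReal hi
    (Filter.Eventually.of_forall fun v => by positivity)]
  exact lintegral_congr fun v => (ENNReal.ofReal_mul (by positivity)).symm

/-- The coordinates `(ψ₀, ψ₁) ∈ ℂ² × ℂ²` of a bipartite vector, where `ψ = e₀ ⊗ ψ₀ + e₁ ⊗ ψ₁`. -/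
def bipartiteEquiv : (EuclideanSpace ℂ (Fin 2) × EuclideanSpace ℂ (Fin 2)) ≃L[ℝ]
    EuclideanSpace ℂ (Fin 2 × Fin 2) :=
  LinearEquiv.toContinuousLinearEquiv
    { toFun := fun p => WithLp.toLp 2 fun i => (![p.1, p.2] i.1) i.2
      invFun := fun v => (WithLp.toLp 2 fun k => v (0, k), WithLp.toLp 2 fun k => v (1, k))
      map_add' := fun p q => by
        ext ⟨i, k⟩; fin_cases i <;> simp
      map_smul' := fun c p => by
        ext ⟨i, k⟩; fin_cases i <;> simp
      left_inv := fun p => by ext <;> simp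
      right_inv := fun v => by
        ext ⟨i, k⟩; fin_cases i <;> simp }

theorem bipartiteEquiv_apply (p : EuclideanSpace ℂ (Fin 2) × EuclideanSpace ℂ (Fin 2))
    (i k : Fin 2) : bipartiteEquiv p (i, k) = (![p.1, p.2] i) k := rfl

/-- The weight of a bipartite vector in `e₀ ⊗ ℂ²`. -/
def topWeight (v : EuclideanSpace ℂ (Fin 2 × Fin 2)) : ℝ := ∑ k, ‖v (0, k)‖ ^ 2

theorem continuous_topWeight : Continuous topWeight := by
  unfold topWeight; fun_prop

theorem topWeight_nonneg (v : EuclideanSpace ℂ (Fin 2 × Fin 2)) : 0 ≤ topWeight v := by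
  unfold topWeight; positivity

theorem topWeight_le (v : EuclideanSpace ℂ (Fin 2 × Fin 2)) : topWeight v ≤ ‖v‖ ^ 2 := by
  rw [EuclideanSpace.norm_sq_eq, Fintype.sum_prod_type, Fin.sum_univ_two, topWeight]
  have : 0 ≤ ∑ k, ‖v (1, k)‖ ^ 2 := by positivity
  linarith

theorem topWeight_smul (c : ℝ) (v : EuclideanSpace ℂ (Fin 2 × Fin 2)) :
    topWeight ((c : ℂ) • v) = c ^ 2 * topWeight v := by
  simp [topWeight, mul_pow, mul_add]

theorem topWeight_bipartiteEquiv (p : EuclideanSpace ℂ (Fin 2) × EuclideanSpace ℂ (Fin 2)) :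
    topWeight (bipartiteEquiv p) = ‖p.1‖ ^ 2 := by
  simp [topWeight, bipartiteEquiv_apply, EuclideanSpace.norm_sq_eq]

theorem norm_sq_bipartiteEquiv (p : EuclideanSpace ℂ (Fin 2) × EuclideanSpace ℂ (Fin 2)) :
    ‖bipartiteEquiv p‖ ^ 2 = ‖p.1‖ ^ 2 + ‖p.2‖ ^ 2 := by
  rw [EuclideanSpace.norm_sq_eq, Fintype.sum_prod_type, Fin.sum_univ_two,
    EuclideanSpace.norm_sq_eq p.1, EuclideanSpace.norm_sq_eq p.2]
  simp [bipartiteEquiv_apply]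

theorem finrank_real_euclidean (n : Type*) [Fintype n] :
    Module.finrank ℝ (EuclideanSpace ℂ n) = 2 * Fintype.card n := by
  rw [← Module.finrank_mul_finrank ℝ ℂ (EuclideanSpace ℂ n)]
  simp

/-- Gaussian moments of the weight, up to a constant independent of the exponent. -/
theorem exists_lintegral_topWeight : ∃ C : ℝ, ∀ k : ℕ,
    ∫⁻ v, ENNReal.ofReal (topWeight v ^ k) * ENNReal.ofReal (Real.exp (-‖v‖ ^ 2)) =
      ENNReal.ofReal C * ENNReal.ofReal ((k + 1).factorial) := by
  let μ : Measure (EuclideanSpace ℂ (Fin 2) × EuclideanSpace ℂ (Fin 2)) := volume.prod volume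
  have : μ.IsAddHaarMeasure := Measure.prod.instIsAddHaarMeasure _ _
  have : (μ.map bipartiteEquiv).IsAddHaarMeasure := bipartiteEquiv.isAddHaarMeasure_map _
  -- Uniqueness of Haar measure relates the two volumes up to a factor `c`, whose value is
  -- irrelevant because only ratios of moments are used.
  have hvol := Measure.isAddLeftInvariant_eq_smul
    (volume : Measure (EuclideanSpace ℂ (Fin 2 × Fin 2))) (μ.map bipartiteEquiv)
  set c := Measure.addHaarScalarFactor (volume : Measure (EuclideanSpace ℂ (Fin 2 × Fin 2)))
    (μ.map bipartiteEquiv)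
  set b : ℝ := volume.real (Metric.ball (0 : EuclideanSpace ℂ (Fin 2)) 1) * ((1 : ℕ) + 1)
  have hb : 0 ≤ b := by positivity
  have hfr : Module.finrank ℝ (EuclideanSpace ℂ (Fin 2)) = 2 * (1 + 1) := by
    rw [finrank_real_euclidean]; simp
  refine ⟨c * b * b, fun k => ?_⟩
  have hm : Measurable fun v : EuclideanSpace ℂ (Fin 2 × Fin 2) =>
      ENNReal.ofReal (topWeight v ^ k) * ENNReal.ofReal (Real.exp (-‖v‖ ^ 2)) := by
    have := continuous_topWeight.measurable
    fun_prop
  have h1 := lintegral_norm_pow_mul_exp (volume : Measure (EuclideanSpace ℂ (Fin 2))) hfr k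
  have h2 := lintegral_norm_pow_mul_exp (volume : Measure (EuclideanSpace ℂ (Fin 2))) hfr 0
  rw [hvol, lintegral_smul_measure, lintegral_map hm bipartiteEquiv.continuous.measurable]
  simp_rw [topWeight_bipartiteEquiv, norm_sq_bipartiteEquiv]
  -- The Gaussian splits over the two components; the second factor is written as a zeroth moment so
  -- that both are instances of the same formula.
  have h3 : ∀ p : EuclideanSpace ℂ (Fin 2) × EuclideanSpace ℂ (Fin 2), ENNReal.ofReal ((‖p.1‖ ^ 2) ^ k) *
      ENNReal.ofReal (Real.exp (-(‖p.1‖ ^ 2 + ‖p.2‖ ^ 2))) =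
      (ENNReal.ofReal (‖p.1‖ ^ (2 * k)) * ENNReal.ofReal (Real.exp (-‖p.1‖ ^ 2))) *
        (ENNReal.ofReal (‖p.2‖ ^ (2 * 0)) * ENNReal.ofReal (Real.exp (-‖p.2‖ ^ 2))) := by
    intro p
    rw [neg_add, Real.exp_add, ENNReal.ofReal_mul (by positivity), pow_mul]
    simp [mul_assoc]
  simp_rw [h3]
  have h4 := lintegral_prod_mul (μ := (volume : Measure (EuclideanSpace ℂ (Fin 2))))
    (ν := (volume : Measure (EuclideanSpace ℂ (Fin 2))))
    (f := fun x => ENNReal.ofReal (‖x‖ ^ (2 * k)) * ENNReal.ofReal (Real.exp (-‖x‖ ^ 2)))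
    (g := fun x => ENNReal.ofReal (‖x‖ ^ (2 * 0)) * ENNReal.ofReal (Real.exp (-‖x‖ ^ 2)))
    (by fun_prop) (by fun_prop)
  rw [h4, h1, h2]
  have hc : (c : ENNReal) = ENNReal.ofReal c := by simp
  rw [ENNReal.smul_def, smul_eq_mul, hc, ← ENNReal.ofReal_mul (by positivity),
    ← ENNReal.ofReal_mul (by positivity), ← ENNReal.ofReal_mul (by positivity),
    ← ENNReal.ofReal_mul (by positivity), ← ENNReal.ofReal_mul (by positivity)]
  congr 1
  simp
  ring

/-- The Gaussian comparison makes the `k`-th moment proportional to `(k + 1)! / (k + 3)!`, the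
factorials coming from real dimensions 4 and 8. The case `k = 0` fixes the constant. -/
theorem integral_topWeight_pow (Φ : PureState (Fin 2 × Fin 2)) (k : ℕ) :
    ∫ U, topWeight (unitaryAct U Φ).1 ^ k ∂haarUnitary (Fin 2 × Fin 2) =
      6 / ((k + 2) * (k + 3)) := by
  obtain ⟨C, hC⟩ := exists_lintegral_topWeight
  have hfr : Module.finrank ℝ (EuclideanSpace ℂ (Fin 2 × Fin 2)) = 2 * (3 + 1) := by
    rw [finrank_real_euclidean]; simp
  set B : ℝ := volume.real (Metric.ball (0 : EuclideanSpace ℂ (Fin 2 × Fin 2)) 1) * ((3 : ℕ) + 1)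
  have hB : 0 < B := by
    have : 0 < volume.real (Metric.ball (0 : EuclideanSpace ℂ (Fin 2 × Fin 2)) 1) :=
      ENNReal.toReal_pos (Metric.measure_ball_pos _ 0 one_pos).ne' measure_ball_lt_top.ne
    positivity
  -- `max C 0` is what `ENNReal.ofReal C` becomes as a real number, since no sign of `C` was
  -- recorded.
  have key : ∀ k : ℕ,
      (∫ U, topWeight (unitaryAct U Φ).1 ^ k ∂haarUnitary (Fin 2 × Fin 2)) *
        (B * (k + 3).factorial) = max C 0 * (k + 1).factorial := by
    intro k
    have h := lintegral_haarUnitary_mul (f := fun v => ENNReal.ofReal (topWeight v ^ k))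
      (ENNReal.continuous_ofReal.comp (continuous_topWeight.pow k)) (d := 2 * k)
      (fun c hc v => by
        rw [topWeight_smul, mul_pow, ← pow_mul, ENNReal.ofReal_mul (by positivity)])
      (w := fun r => ENNReal.ofReal (Real.exp (-r ^ 2))) (by fun_prop) Φ
    rw [hC, lintegral_norm_pow_mul_exp _ hfr] at h
    have h' := congrArg ENNReal.toReal h
    simp only [ENNReal.toReal_mul, ENNReal.toReal_ofReal',
      max_eq_left (Nat.cast_nonneg (α := ℝ) _)] at h'
    rw [integral_eq_lintegral_of_nonneg_ae
      (Filter.Eventually.of_forall fun U => pow_nonneg (topWeight_nonneg _) k)]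
    · rw [← max_eq_left hB.le]
      exact h'
    · exact ((continuous_topWeight.comp (continuous_unitaryAct Φ)).pow k).aestronglyMeasurable
  have h0 := key 0
  simp only [pow_zero, integral_const, probReal_univ, smul_eq_mul, mul_one] at h0
  have hk := key k
  norm_num [Nat.factorial] at h0
  rw [← h0, show k + 3 = k + 1 + 1 + 1 by ring, Nat.factorial_succ, Nat.factorial_succ] at hk
  have hf : ((k + 1).factorial : ℝ) ≠ 0 := by positivity
  rw [eq_div_iff (by positivity)]
  push_cast at hk
  have hne : B * ((k + 1).factorial : ℝ) ≠ 0 := by positivity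
  apply mul_right_cancel₀ hne
  linear_combination hk

/-- For a Haar-random bipartite qubit state, the weight in `e₀ ⊗ ℂ²` is beta distributed. -/
theorem map_topWeight (Φ : PureState (Fin 2 × Fin 2)) :
    (haarUnitary (Fin 2 × Fin 2)).map (fun U => topWeight (unitaryAct U Φ).1) = betaLaw := by
  have hm : Measurable fun U : Matrix.unitaryGroup (Fin 2 × Fin 2) ℂ =>
      topWeight (unitaryAct U Φ).1 :=
    (continuous_topWeight.comp (continuous_unitaryAct Φ)).measurable
  have : IsProbabilityMeasure ((haarUnitary (Fin 2 × Fin 2)).map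
      (fun U => topWeight (unitaryAct U Φ).1)) :=
    Measure.isProbabilityMeasure_map hm.aemeasurable
  refine ext_of_moments (a := 0) (b := 1) ?_ ae_mem_betaLaw fun k => ?_
  · rw [ae_map_iff (p := fun x => x ∈ Set.Icc (0 : ℝ) 1) hm.aemeasurable measurableSet_Icc]
    refine Filter.Eventually.of_forall fun U => ⟨topWeight_nonneg _, (topWeight_le _).trans ?_⟩
    rw [(unitaryAct U Φ).2, one_pow]
  · rw [integral_map hm.aemeasurable (by fun_prop), integral_topWeight_pow, integral_pow_betaLaw]

/-! ### From the weight to the mean of a Hermitian observable -/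

/-- The diagonal entries of the reduced state are the weights in `e₀ ⊗ ℂ²` and `e₁ ⊗ ℂ²`, which add
up to one. -/
theorem mean_diagonal_reducedState (d : Fin 2 → ℝ) (ψ : PureState (Fin 2 × Fin 2)) :
    mean (Matrix.diagonal fun i => (d i : ℂ)) (reducedState ψ) =
      (d 0 - d 1) * topWeight ψ.1 + d 1 := by
  have h : ∑ i, ∑ k, ‖ψ.1 (i, k)‖ ^ 2 = 1 := by
    rw [← Fintype.sum_prod_type', ← EuclideanSpace.norm_sq_eq, ψ.2, one_pow]
  have h2 : mean (Matrix.diagonal fun i => (d i : ℂ)) (reducedState ψ) =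
      ∑ i, d i * ∑ k, ‖ψ.1 (i, k)‖ ^ 2 := by
    simp [mean, reducedState, partialTrace, projector, Matrix.trace, Matrix.vecMulVec_apply,
      Matrix.diagonal_mul, Complex.mul_conj, Complex.normSq_eq_norm_sq]
    norm_cast
  rw [h2, topWeight]
  rw [Fin.sum_univ_two] at h ⊢
  linear_combination d 1 * h

open scoped Kronecker in
/-- The unitary `W ⊗ 𝟙`. -/
def localUnitary (W : Matrix.unitaryGroup (Fin 2) ℂ) : Matrix.unitaryGroup (Fin 2 × Fin 2) ℂ :=
  ⟨W.1 ⊗ₖ (1 : Matrix (Fin 2) (Fin 2) ℂ), Matrix.kronecker_mem_unitary W.2 (one_mem _)⟩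

theorem reducedState_localUnitary (W : Matrix.unitaryGroup (Fin 2) ℂ)
    (ψ : PureState (Fin 2 × Fin 2)) :
    (reducedState (unitaryAct (localUnitary W) ψ)).1 = W.1 * (reducedState ψ).1 * star W.1 := by
  ext i j
  fin_cases i <;> fin_cases j <;>
  simp [reducedState, partialTrace, projector, unitaryAct, localUnitary, Matrix.mul_apply,
    Matrix.vecMulVec_apply, Matrix.toLpLin_apply, Matrix.mulVec, dotProduct, Fintype.sum_prod_type,
    Fin.sum_univ_two, Matrix.one_apply] <;> ring

theorem continuous_mean {n : Type*} [Fintype n] (A : Matrix n n ℂ) :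
    Continuous (mean A : DensityMatrix n → ℝ) := by
  unfold mean
  exact Complex.continuous_re.comp
    (Continuous.matrix_trace (continuous_const.matrix_mul continuous_subtype_val))

theorem continuous_partialTrace_projector {m n : Type*} [Fintype m] [Fintype n] :
    Continuous fun v : EuclideanSpace ℂ (m × n) => partialTrace (projector v) := by
  refine continuous_matrix fun i j => ?_
  have h : ∀ v : EuclideanSpace ℂ (m × n), partialTrace (projector v) i j =
      ∑ k, v (i, k) * star (v (j, k)) := fun v => rfl
  simp_rw [h]
  fun_prop

theorem continuous_reducedState_unitaryAct {n : Type*} [Fintype n] [DecidableEq n]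
    (Φ : PureState (n × n)) :
    Continuous fun U : Matrix.unitaryGroup (n × n) ℂ => reducedState (unitaryAct U Φ) := by
  exact Continuous.subtype_mk (continuous_partialTrace_projector.comp (continuous_unitaryAct Φ)) _

theorem map_stateMeasure {n : Type*} [Fintype n] [DecidableEq n] (Φ : PureState (n × n))
    {β : Type*} [MeasurableSpace β] {f : DensityMatrix n → β} (hf : Measurable f) :
    (stateMeasure Φ).map f =
      (haarUnitary (n × n)).map fun U => f (reducedState (unitaryAct U Φ)) := by
  rw [stateMeasure, Measure.map_map hf (continuous_reducedState_unitaryAct Φ).measurable]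
  rfl

instance {n : Type*} [Fintype n] [DecidableEq n] (Φ : PureState (n × n)) :
    IsProbabilityMeasure (stateMeasure Φ) :=
  Measure.isProbabilityMeasure_map (continuous_reducedState_unitaryAct Φ).measurable.aemeasurable

/-- The law of the mean value of an observable depends only on its eigenvalues. -/
theorem map_mean_eq_of_hermitian {A : Matrix (Fin 2) (Fin 2) ℂ} (hA : A.IsHermitian)
    (Φ : PureState (Fin 2 × Fin 2)) :
    (stateMeasure Φ).map (mean A) =
      betaLaw.map fun u => (hA.eigenvalues 0 - hA.eigenvalues 1) * u + hA.eigenvalues 1 := by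
  set W := hA.eigenvectorUnitary
  set d := hA.eigenvalues
  have hmean : ∀ ψ : PureState (Fin 2 × Fin 2), mean A (reducedState ψ) =
      (d 0 - d 1) * topWeight (unitaryAct (localUnitary W⁻¹) ψ).1 + d 1 := by
    intro ψ
    rw [← mean_diagonal_reducedState d, mean, mean, reducedState_localUnitary]
    have hA' : A = W.1 * Matrix.diagonal (fun i => (d i : ℂ)) * star W.1 := by
      have := hA.spectral_theorem
      rw [Unitary.conjStarAlgAut_apply] at this
      exact this
    have h1 : (W⁻¹).1 = star W.1 := rfl
    conv_lhs => rw [hA', Matrix.mul_assoc, Matrix.mul_assoc, Matrix.trace_mul_comm]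
    rw [h1, star_star, Matrix.mul_assoc, Matrix.mul_assoc]
  have hm : Measurable fun U : Matrix.unitaryGroup (Fin 2 × Fin 2) ℂ =>
      topWeight (unitaryAct U Φ).1 :=
    (continuous_topWeight.comp (continuous_unitaryAct Φ)).measurable
  rw [map_stateMeasure Φ (continuous_mean A).measurable, ← map_topWeight Φ,
    Measure.map_map (by fun_prop) hm]
  simp_rw [hmean, ← unitaryAct_mul]
  -- The diagonalizing rotation acts on the left of `U`, so left invariance removes it.
  conv_rhs => rw [← map_mul_left_haarUnitary (localUnitary W⁻¹),
    Measure.map_map (by fun_prop) (measurable_const_mul _)]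
  rfl

/-! ### Qubit observables: spectrum and law of a single mean -/

theorem observable_eq (a₀ : ℝ) (a : EuclideanSpace ℝ (Fin 3)) :
    observable a₀ a = !![(a₀ : ℂ) + a 2, a 0 - a 1 * Complex.I; a 0 + a 1 * Complex.I, a₀ - a 2] := by
  ext i j
  fin_cases i <;> fin_cases j <;>
    simp [observable, pauli, Fin.sum_univ_three, sub_eq_add_neg]

theorem observable_isHermitian (a₀ : ℝ) (a : EuclideanSpace ℝ (Fin 3)) :
    (observable a₀ a).IsHermitian := by
  rw [observable_eq]
  ext i j
  fin_cases i <;> fin_cases j <;> simp [sub_eq_add_neg]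

theorem norm_sq_fin_three (a : EuclideanSpace ℝ (Fin 3)) :
    ‖a‖ ^ 2 = a 0 ^ 2 + a 1 ^ 2 + a 2 ^ 2 := by
  simp [EuclideanSpace.norm_sq_eq, Fin.sum_univ_three]

theorem trace_observable (a₀ : ℝ) (a : EuclideanSpace ℝ (Fin 3)) :
    (observable a₀ a).trace = ((2 * a₀ : ℝ) : ℂ) := by
  rw [observable_eq, Matrix.trace_fin_two_of]; push_cast; ring

theorem det_observable (a₀ : ℝ) (a : EuclideanSpace ℝ (Fin 3)) :
    (observable a₀ a).det = ((a₀ ^ 2 - ‖a‖ ^ 2 : ℝ) : ℂ) := by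
  rw [observable_eq, Matrix.det_fin_two_of, norm_sq_fin_three]; push_cast
  linear_combination (-(a 1 : ℂ) ^ 2) * Complex.I_sq.symm

/-- `r 𝟙 - A` is itself an observable, with parameters `r - a₀` and `-a`, so it is singular exactly
when `(r - a₀)² = ‖a‖²`. -/
theorem spectrum_observable (a₀ : ℝ) (a : EuclideanSpace ℝ (Fin 3)) :
    spectrum ℝ (observable a₀ a) = {a₀ - ‖a‖, a₀ + ‖a‖} := by
  ext r
  have h : algebraMap ℝ (Matrix (Fin 2) (Fin 2) ℂ) r - observable a₀ a =
      observable (r - a₀) (-a) := by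
    rw [observable_eq, observable_eq]
    ext i j
    fin_cases i <;> fin_cases j <;> simp [Matrix.algebraMap_matrix_apply] <;> ring
  rw [spectrum.mem_iff, h, Matrix.isUnit_iff_isUnit_det, det_observable, isUnit_iff_ne_zero,
    not_not, Complex.ofReal_eq_zero, norm_neg, sub_eq_zero, sq_eq_sq_iff_eq_or_eq_neg]
  simp only [Set.mem_insert_iff, Set.mem_singleton_iff]
  constructor
  · rintro (h | h)
    · right; linarith
    · left; linarith
  · rintro (h | h)
    · right; linarith
    · left; linarith

theorem eigMin_observable (a₀ : ℝ) (a : EuclideanSpace ℝ (Fin 3)) :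
    eigMin (observable a₀ a) = a₀ - ‖a‖ := by
  rw [eigMin, spectrum_observable, csInf_pair]
  exact min_eq_left (by linarith [norm_nonneg a])

theorem eigMax_observable (a₀ : ℝ) (a : EuclideanSpace ℝ (Fin 3)) :
    eigMax (observable a₀ a) = a₀ + ‖a‖ := by
  rw [eigMax, spectrum_observable, csSup_pair]
  exact max_eq_right (by linarith [norm_nonneg a])

/-- The mean value of a qubit observable in a random state is distributed as an affine function of
a coordinate of the disc. -/
theorem map_mean_observable (Φ : PureState (Fin 2 × Fin 2)) (a₀ : ℝ)
    (a : EuclideanSpace ℝ (Fin 3)) :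
    (stateMeasure Φ).map (mean (observable a₀ a)) = discLaw.map fun p => ‖a‖ * p.1 + a₀ := by
  have hA := observable_isHermitian a₀ a
  have ht : hA.eigenvalues 0 + hA.eigenvalues 1 = 2 * a₀ := by
    have h := hA.trace_eq_sum_eigenvalues
    rw [trace_observable, Fin.sum_univ_two] at h
    exact Complex.ofReal_injective ((Complex.ofReal_add _ _).trans h.symm)
  have hd : hA.eigenvalues 0 * hA.eigenvalues 1 = a₀ ^ 2 - ‖a‖ ^ 2 := by
    have h := hA.det_eq_prod_eigenvalues
    rw [det_observable, Fin.prod_univ_two] at h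
    exact Complex.ofReal_injective ((Complex.ofReal_mul _ _).trans h.symm)
  rw [map_mean_eq_of_hermitian hA]
  set x := hA.eigenvalues 0
  set y := hA.eigenvalues 1
  have h1 : (fun u => (x - y) * u + y) =
      (fun z => (x - y) / 2 * z + a₀) ∘ fun u => 2 * u + (-1) := by
    ext u; simp only [Function.comp]; linear_combination (1 / 2) * ht
  -- Trace and determinant give only `((x - y) / 2)² = ‖a‖²`; the order of the eigenvalues is
  -- immaterial by symmetry of the disc.
  have h2 := map_linear_discLaw ((x - y) / 2) 0 ‖a‖ (by
    have hx : x = 2 * a₀ - y := by linarith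
    rw [hx] at hd ⊢
    linear_combination -hd)
  rw [h1, ← Measure.map_map (by fun_prop) (by fun_prop), map_betaLaw_eq_map_fst_discLaw,
    Measure.map_map (by fun_prop) (by fun_prop)]
  have h3 := congrArg (Measure.map fun z => z + a₀) h2
  rw [Measure.map_map (by fun_prop) (by fun_prop), Measure.map_map (by fun_prop) (by fun_prop)]
    at h3
  refine Eq.trans ?_ h3
  congr 1
  ext p
  simp [Function.comp]

/-- This closure under linear combinations lets Cramér–Wold reduce the joint law to single
observables. -/
theorem mean_observable_combination (a₀ b₀ s t : ℝ) (a b : EuclideanSpace ℝ (Fin 3))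
    (ρ : DensityMatrix (Fin 2)) :
    s * mean (observable a₀ a) ρ + t * mean (observable b₀ b) ρ =
      mean (observable (s * a₀ + t * b₀) (s • a + t • b)) ρ := by
  have h : observable (s * a₀ + t * b₀) (s • a + t • b) =
      s • observable a₀ a + t • observable b₀ b := by
    simp only [observable_eq]
    ext i j
    fin_cases i <;> fin_cases j <;> simp <;> ring
  rw [h]
  simp only [mean, Matrix.add_mul, Matrix.smul_mul, Matrix.trace_add, Matrix.trace_smul,
    Complex.add_re, Complex.smul_re, smul_eq_mul]

theorem measurable_mean {n : Type*} [Fintype n] (A : Matrix n n ℂ) :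
    Measurable (mean A : DensityMatrix n → ℝ) :=
  (continuous_mean A).measurable

/-! ### The Gram matrix and the joint density -/

theorem det_gramT (a b : EuclideanSpace ℝ (Fin 3)) :
    (gramT a b).det = ‖a‖ ^ 2 * ‖b‖ ^ 2 - inner ℝ a b ^ 2 := by
  rw [gramT, Matrix.det_fin_two_of, real_inner_comm a b, real_inner_self_eq_norm_sq,
    real_inner_self_eq_norm_sq]
  ring

theorem det_gramT_pos {a b : EuclideanSpace ℝ (Fin 3)} (h : LinearIndependent ℝ ![a, b]) :
    0 < (gramT a b).det := by
  have ha : a ≠ 0 := h.ne_zero 0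
  have ha' : 0 < ‖a‖ := norm_pos_iff.mpr ha
  -- This is the Gram–Schmidt component of `b` orthogonal to `a`, scaled by `‖a‖²`; its squared norm
  -- is `‖a‖² det T`.
  have hne : ‖a‖ ^ 2 • b - inner ℝ a b • a ≠ 0 := by
    intro h0
    rw [LinearIndependent.pair_iff] at h
    have := (h (-inner ℝ a b) (‖a‖ ^ 2) (by rw [← h0]; module)).2
    exact (pow_pos ha' 2).ne' this
  have hp : 0 < ‖‖a‖ ^ 2 • b - inner ℝ a b • a‖ ^ 2 := by positivity
  rw [norm_sub_sq_real, norm_smul, norm_smul, inner_smul_left, inner_smul_right,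
    real_inner_comm a b, mul_pow, mul_pow, Real.norm_eq_abs, Real.norm_eq_abs, sq_abs, sq_abs] at hp
  simp only [conj_trivial] at hp
  rw [det_gramT]
  have h2 : 0 < ‖a‖ ^ 2 * (‖a‖ ^ 2 * ‖b‖ ^ 2 - inner ℝ a b ^ 2) := by
    refine hp.trans_eq ?_
    ring
  exact pos_of_mul_pos_right h2 (by positivity)

theorem quadForm_inv_gramT (a b : EuclideanSpace ℝ (Fin 3)) (u v : ℝ) :
    ![u, v] ⬝ᵥ (gramT a b)⁻¹.mulVec ![u, v] =
      (‖b‖ ^ 2 * u ^ 2 - 2 * inner ℝ a b * u * v + ‖a‖ ^ 2 * v ^ 2) / (gramT a b).det := by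
  rw [Matrix.inv_def, Ring.inverse_eq_inv', Matrix.smul_mulVec, dotProduct_smul, smul_eq_mul,
    div_eq_inv_mul]
  congr 1
  rw [gramT, Matrix.adjugate_fin_two_of, real_inner_comm a b, real_inner_self_eq_norm_sq,
    real_inner_self_eq_norm_sq]
  simp [Matrix.mulVec, dotProduct, Fin.sum_univ_two]
  ring

/-- The Heaviside factor is redundant because the real square root vanishes on negative arguments.
-/
theorem sqrt_mul_heaviside (x : ℝ) (hx : 0 ≤ x) :
    √(1 - x ^ 2) * heaviside (1 - x) = √(1 - x ^ 2) := by
  rw [heaviside]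
  split_ifs with h
  · rw [mul_one]
  · rw [mul_zero, eq_comm, Real.sqrt_eq_zero']
    nlinarith

/-- The law with density `jointDensity` is the image of the law on the disc under an affine map
given by the Cholesky factor of the Gram matrix. -/
theorem map_affine_discLaw {a b : EuclideanSpace ℝ (Fin 3)} (h : LinearIndependent ℝ ![a, b])
    (a₀ b₀ : ℝ) :
    discLaw.map (fun p => (‖a‖ * p.1 + a₀,
      inner ℝ a b / ‖a‖ * p.1 + √(gramT a b).det / ‖a‖ * p.2 + b₀)) =
    volume.withDensity fun p => ENNReal.ofReal (jointDensity a₀ b₀ a b p.1 p.2) := by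
  have hd := det_gramT_pos h
  have ha : 0 < ‖a‖ := norm_pos_iff.mpr (h.ne_zero 0)
  set D := (gramT a b).det with hD
  have hs : 0 < √D := Real.sqrt_pos.mpr hd
  have hs2 : √D ^ 2 = D := Real.sq_sqrt hd.le
  have hdet : ‖a‖ * (√D / ‖a‖) - 0 * (inner ℝ a b / ‖a‖) = √D := by
    rw [zero_mul, sub_zero]; exact mul_div_cancel₀ _ ha.ne'
  have hlin := map_planeMap_volume (a := ‖a‖) (b := 0) (c := inner ℝ a b / ‖a‖) (d := √D / ‖a‖)
    (by rw [hdet]; exact hs.ne')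
  rw [hdet] at hlin
  have hvol : (volume : Measure (ℝ × ℝ)).map (fun p => (‖a‖ * p.1 + a₀,
      inner ℝ a b / ‖a‖ * p.1 + √D / ‖a‖ * p.2 + b₀)) = ENNReal.ofReal |(√D)⁻¹| • volume := by
    have := congrArg (Measure.map fun q : ℝ × ℝ => q + (a₀, b₀)) hlin
    rw [Measure.map_map (by fun_prop) (by fun_prop), Measure.map_smul, map_add_right_eq_self]
      at this
    rw [← this]
    congr 1
    ext p <;> simp
  have hω : ∀ r s, omega a₀ b₀ a b r s ^ 2 = (‖b‖ ^ 2 * (r - a₀) ^ 2 -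
      2 * inner ℝ a b * (r - a₀) * (s - b₀) + ‖a‖ ^ 2 * (s - b₀) ^ 2) / D := by
    intro r s
    rw [omega, quadForm_inv_gramT, Real.sq_sqrt]
    refine div_nonneg ?_ hd.le
    -- Completing the square: `‖a‖²` times the form is `D (r - a₀)²` plus a square.
    have h1 : 0 ≤ ‖a‖ ^ 2 * (‖b‖ ^ 2 * (r - a₀) ^ 2 -
      2 * inner ℝ a b * (r - a₀) * (s - b₀) + ‖a‖ ^ 2 * (s - b₀) ^ 2) := by
      have h2 : 0 ≤ D * (r - a₀) ^ 2 + (inner ℝ a b * (r - a₀) - ‖a‖ ^ 2 * (s - b₀)) ^ 2 := by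
        positivity
      rw [hD, det_gramT] at h2
      refine h2.trans_eq ?_
      ring
    exact nonneg_of_mul_nonneg_right h1 (by positivity)
  -- If `L` is the Cholesky factor, `T = L Lᵀ`, then `T⁻¹` evaluated at `L p` is `|p|²`.
  have hN : ∀ p : ℝ × ℝ, omega a₀ b₀ a b (‖a‖ * p.1 + a₀)
      (inner ℝ a b / ‖a‖ * p.1 + √D / ‖a‖ * p.2 + b₀) ^ 2 = p.1 ^ 2 + p.2 ^ 2 := by
    intro p
    rw [hω, div_eq_iff hd.ne']
    simp only [add_sub_cancel_right]
    have e1 : ‖a‖ * (inner ℝ a b / ‖a‖ * p.1 + √D / ‖a‖ * p.2) = inner ℝ a b * p.1 + √D * p.2 := by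
      field_simp
    have e2 : D = ‖a‖ ^ 2 * ‖b‖ ^ 2 - inner ℝ a b ^ 2 := det_gramT a b
    generalize inner ℝ a b / ‖a‖ * p.1 + √D / ‖a‖ * p.2 = z at e1 ⊢
    linear_combination (‖a‖ * z + √D * p.2 - inner ℝ a b * p.1) * e1 + p.2 ^ 2 * hs2 - p.1 ^ 2 * e2
  have hmω : Measurable fun q : ℝ × ℝ => omega a₀ b₀ a b q.1 q.2 ^ 2 := by
    simp_rw [hω]; fun_prop
  have hmap := map_withDensity_comp (g := fun q : ℝ × ℝ =>
    ENNReal.ofReal (3 / (2 * Real.pi) * √(1 - omega a₀ b₀ a b q.1 q.2 ^ 2)))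
    (by fun_prop) (by fun_prop) hvol
  have hcomp : ((fun q : ℝ × ℝ =>
      ENNReal.ofReal (3 / (2 * Real.pi) * √(1 - omega a₀ b₀ a b q.1 q.2 ^ 2))) ∘
      fun p : ℝ × ℝ => (‖a‖ * p.1 + a₀, inner ℝ a b / ‖a‖ * p.1 + √D / ‖a‖ * p.2 + b₀)) =
      fun p => ENNReal.ofReal (3 / (2 * Real.pi) * √(1 - (p.1 ^ 2 + p.2 ^ 2))) := by
    ext p
    simp only [Function.comp, hN]
  rw [hcomp] at hmap
  rw [discLaw, hmap, ← withDensity_smul _ (by fun_prop)]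
  congr 1
  ext q
  rw [Pi.smul_apply, smul_eq_mul, ← ENNReal.ofReal_mul (abs_nonneg _), jointDensity, mul_assoc,
    sqrt_mul_heaviside (omega a₀ b₀ a b q.1 q.2) (Real.sqrt_nonneg _), abs_of_pos (inv_pos.mpr hs), ← hD]
  congr 1
  field_simp

theorem map_mean_pair_of_linearIndependent (Φ : PureState (Fin 2 × Fin 2)) (a₀ b₀ : ℝ)
    {a b : EuclideanSpace ℝ (Fin 3)} (h : LinearIndependent ℝ ![a, b]) :
    (stateMeasure Φ).map (fun ρ => (mean (observable a₀ a) ρ, mean (observable b₀ b) ρ)) =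
      volume.withDensity fun p => ENNReal.ofReal (jointDensity a₀ b₀ a b p.1 p.2) := by
  rw [← map_affine_discLaw h]
  have hm : Measurable fun ρ : DensityMatrix (Fin 2) =>
      (mean (observable a₀ a) ρ, mean (observable b₀ b) ρ) :=
    (measurable_mean _).prodMk (measurable_mean _)
  have : IsProbabilityMeasure ((stateMeasure Φ).map
      fun ρ => (mean (observable a₀ a) ρ, mean (observable b₀ b) ρ)) :=
    Measure.isProbabilityMeasure_map hm.aemeasurable
  have ha : 0 < ‖a‖ := norm_pos_iff.mpr (h.ne_zero 0)
  have hs2 : √(gramT a b).det ^ 2 = ‖a‖ ^ 2 * ‖b‖ ^ 2 - inner ℝ a b ^ 2 := by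
    rw [Real.sq_sqrt (det_gramT_pos h).le, det_gramT]
  generalize √(gramT a b).det = D at hs2 ⊢
  refine ext_of_map_linear fun s t => ?_
  rw [Measure.map_map (by fun_prop) hm, Measure.map_map (by fun_prop) (by fun_prop)]
  have h1 : ((fun p : ℝ × ℝ => s * p.1 + t * p.2) ∘ fun ρ : DensityMatrix (Fin 2) =>
      (mean (observable a₀ a) ρ, mean (observable b₀ b) ρ)) =
      mean (observable (s * a₀ + t * b₀) (s • a + t • b)) :=
    funext fun ρ => mean_observable_combination a₀ b₀ s t a b ρ
  rw [h1, map_mean_observable]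
  -- The two coefficients form `Lᵀ(s, t)`, whose squared length is `(s, t) T (s, t)ᵀ = ‖s a + t
  -- b‖²`.
  have h2 := map_linear_discLaw (s * ‖a‖ + t * (inner ℝ a b / ‖a‖)) (t * (D / ‖a‖)) ‖s • a + t • b‖
    (by
      rw [norm_add_sq_real, norm_smul, norm_smul, inner_smul_left, inner_smul_right,
        mul_pow ‖s‖, mul_pow ‖t‖, Real.norm_eq_abs, Real.norm_eq_abs, sq_abs, sq_abs]
      simp only [conj_trivial]
      field_simp
      linear_combination t ^ 2 * hs2)
  have h3 := congrArg (Measure.map fun z => z + (s * a₀ + t * b₀)) h2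
  rw [Measure.map_map (by fun_prop) (by fun_prop), Measure.map_map (by fun_prop) (by fun_prop)]
    at h3
  refine h3.symm.trans ?_
  congr 1
  ext p
  simp only [Function.comp]
  ring

/-! ### The density of a single mean and the degenerate case -/

theorem map_mean_eq_withDensity (Φ : PureState (Fin 2 × Fin 2)) (a₀ : ℝ)
    {a : EuclideanSpace ℝ (Fin 3)} (ha : a ≠ 0) :
    (stateMeasure Φ).map (mean (observable a₀ a)) =
      volume.withDensity fun r => ENNReal.ofReal (meanDensity (observable a₀ a) r) := by
  have ha' : 0 < ‖a‖ := norm_pos_iff.mpr ha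
  -- Outside the spectral interval the quadratic is nonpositive, so `ENNReal.ofReal` already does
  -- the work of the Heaviside difference; at the upper endpoint both sides vanish.
  have hdens : ∀ r, ENNReal.ofReal (meanDensity (observable a₀ a) r) =
      ENNReal.ofReal (3 / (4 * ‖a‖ ^ 3) * (r - (a₀ - ‖a‖)) * (a₀ + ‖a‖ - r)) := by
    intro r
    have hV : (Nat.factorial 3 : ℝ) / (a₀ + ‖a‖ - (a₀ - ‖a‖)) ^ 3 = 3 / (4 * ‖a‖ ^ 3) := by
      rw [show a₀ + ‖a‖ - (a₀ - ‖a‖) = 2 * ‖a‖ by ring]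
      norm_num [Nat.factorial]
      field_simp
      norm_num
    rw [meanDensity, eigMin_observable, eigMax_observable, hV]
    have hk : 0 < 3 / (4 * ‖a‖ ^ 3) := by positivity
    generalize 3 / (4 * ‖a‖ ^ 3) = K at hk ⊢
    have hneg : ∀ x y : ℝ, x ≤ 0 → 0 ≤ y → K * x * y ≤ 0 := fun x y hx hy =>
      mul_nonpos_of_nonpos_of_nonneg (mul_nonpos_of_nonneg_of_nonpos hk.le hx) hy
    rcases lt_or_ge r (a₀ - ‖a‖) with h1 | h1
    · rw [heaviside, heaviside, if_neg (by linarith), if_neg (by linarith), sub_zero, mul_zero,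
        ENNReal.ofReal_zero, ENNReal.ofReal_of_nonpos (hneg _ _ (by linarith) (by linarith))]
    · rcases lt_or_ge r (a₀ + ‖a‖) with h2 | h2
      · rw [heaviside, heaviside, if_pos (by linarith), if_neg (by linarith), sub_zero, mul_one]
      · rw [heaviside, heaviside, if_pos (by linarith), if_pos (by linarith), sub_self, mul_zero,
          ENNReal.ofReal_zero, mul_right_comm,
          ENNReal.ofReal_of_nonpos]
        exact mul_nonpos_of_nonpos_of_nonneg
          (mul_nonpos_of_nonneg_of_nonpos hk.le (by linarith)) (by linarith)
  simp_rw [hdens]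
  have h1 : (fun p : ℝ × ℝ => ‖a‖ * p.1 + a₀) = (fun x => ‖a‖ * x + a₀) ∘ Prod.fst := rfl
  rw [map_mean_observable, h1, ← Measure.map_map (by fun_prop) (by fun_prop), map_fst_discLaw]
  refine map_mul_add_withDensity ha'.ne' (by fun_prop) fun x => ?_
  rw [abs_of_pos ha']
  field_simp
  ring

theorem map_mean_pair_of_smul (Φ : PureState (Fin 2 × Fin 2)) (a₀ b₀ κ : ℝ)
    {a : EuclideanSpace ℝ (Fin 3)} (ha : a ≠ 0) :
    (stateMeasure Φ).map (fun ρ => (mean (observable a₀ a) ρ, mean (observable b₀ (κ • a)) ρ)) =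
      (deltaLine a₀ b₀ κ).withDensity
        fun p => ENNReal.ofReal (meanDensity (observable a₀ a) p.1) := by
  have hmd : Measurable (meanDensity (observable a₀ a)) := by
    have hh : Measurable heaviside :=
      Measurable.ite measurableSet_Ici measurable_const measurable_const
    unfold meanDensity
    fun_prop
  have hline : Measurable fun r : ℝ => (r, b₀ + κ * (r - a₀)) := by fun_prop
  have h1 : (fun ρ : DensityMatrix (Fin 2) =>
      (mean (observable a₀ a) ρ, mean (observable b₀ (κ • a)) ρ)) =
      (fun r : ℝ => (r, b₀ + κ * (r - a₀))) ∘ mean (observable a₀ a) := by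
    ext ρ
    · rfl
    -- The second observable is `κ A` plus the scalar `b₀ - κ a₀`, and a scalar has itself as mean
    -- because `ρ` has trace one.
    · have h := mean_observable_combination a₀ (b₀ - κ * a₀) κ 1 a 0 ρ
      have h0 : mean (observable (b₀ - κ * a₀) 0) ρ = b₀ - κ * a₀ := by
        have : observable (b₀ - κ * a₀) 0 = ((b₀ - κ * a₀ : ℝ) : ℂ) • 1 := by
          simp [observable]
        rw [this, mean, Matrix.smul_mul, Matrix.one_mul, Matrix.trace_smul, ρ.2.2]
        simp
      rw [h0, smul_zero, add_zero, show κ * a₀ + 1 * (b₀ - κ * a₀) = b₀ by ring] at h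
      simp only [Function.comp, ← h]
      ring
  rw [h1, ← Measure.map_map hline (measurable_mean _), map_mean_eq_withDensity Φ a₀ ha]
  have := map_withDensity_comp (μ := volume) (ν := deltaLine a₀ b₀ κ) (c := 1)
    (g := fun p => ENNReal.ofReal (meanDensity (observable a₀ a) p.1)) hline (by fun_prop)
    (by rw [one_smul]; rfl)
  rw [one_smul] at this
  exact this

theorem exists_eq_smul_of_not_linearIndependent {E : Type*} [AddCommGroup E] [Module ℝ E] {a b : E}
    (ha : a ≠ 0) (h : ¬ LinearIndependent ℝ ![a, b]) : ∃ κ : ℝ, b = κ • a := by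
  rw [LinearIndependent.pair_iff' ha] at h
  push Not at h
  obtain ⟨κ, hκ⟩ := h
  exact ⟨κ, hκ.symm⟩

end QubitMean

end

theorem proposition7 (Φ : QubitMean.PureState (Fin 2 × Fin 2))
    (a₀ b₀ : ℝ) (a b : EuclideanSpace ℝ (Fin 3)) :
    (LinearIndependent ℝ ![a, b] →
      (QubitMean.stateMeasure Φ).map
          (fun ρ => (QubitMean.mean (QubitMean.observable a₀ a) ρ,
            QubitMean.mean (QubitMean.observable b₀ b) ρ)) =
        (volume : Measure (ℝ × ℝ)).withDensity
          (fun p => ENNReal.ofReal (QubitMean.jointDensity a₀ b₀ a b p.1 p.2))) ∧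
    (a ≠ 0 → ¬ LinearIndependent ℝ ![a, b] →
      ∃ κ : ℝ, b = κ • a ∧ (b ≠ 0 → κ ≠ 0) ∧
        (QubitMean.stateMeasure Φ).map (QubitMean.mean (QubitMean.observable a₀ a)) =
          (volume : Measure ℝ).withDensity
            (fun r => ENNReal.ofReal (QubitMean.meanDensity (QubitMean.observable a₀ a) r)) ∧
        (QubitMean.stateMeasure Φ).map
            (fun ρ => (QubitMean.mean (QubitMean.observable a₀ a) ρ,
              QubitMean.mean (QubitMean.observable b₀ b) ρ)) =
          (QubitMean.deltaLine a₀ b₀ κ).withDensity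
            (fun p => ENNReal.ofReal
              (QubitMean.meanDensity (QubitMean.observable a₀ a) p.1))) := by

  refine ⟨QubitMean.map_mean_pair_of_linearIndependent Φ a₀ b₀, fun ha hab => ?_⟩
  obtain ⟨κ, rfl⟩ := QubitMean.exists_eq_smul_of_not_linearIndependent ha hab
  exact ⟨κ, rfl, fun h => (smul_ne_zero_iff.mp h).1, QubitMean.map_mean_eq_withDensity Φ a₀ ha,
    QubitMean.map_mean_pair_of_smul Φ a₀ b₀ κ ha⟩
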